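/- All digraphs are finite, without loops or multiple arcs. For a digraph $D$ with vertices $1,\dots,n$ let $A(D)$ be its adjacency matrix, with $(i,j)$ entry $1$ if $(i,j)$ is an arc and $0$ otherwise; let the spectral radius $\rho(D)$ be the largest modulus of the complex eigenvalues of $A(D)$, and let the complementarity spectrum $\Pi(D)$ be the set of all $\lambda\in\mathbb{R}$ for which there is a nonzero vector $x\in\mathbb{R}^n$ with $x\ge 0$, $A(D)x\ge\lambda x$ (coordinatewise) and $\langle x, A(D)x-\lambda x\rangle=0$. For integers $r,s\ge 2$ let $\infty(r,s)$ be the digraph obtained from the disjoint union of the directed cycles $1\to 2\to\cdots\to r\to 1$ and $1'\to 2'\to\cdots\to s'\to 1'$ by identifying the vertices $1$ and $1'$, and let $\widehat{\infty}(r,s)$ be the digraph obtained from $\infty(r,s)$ by adding the arc $(r,2')$. **Theorem.** Let $2\le r<s$ be integers and let $n=r+s-1$. Then the digraphs $\widehat{\infty}(r,s)$ and $\widehat{\infty}(s,r)$ are not isomorphic, both have order (number of vertices) $n$ and size (number of arcs) $r+s+1$, and they have the same spectral radius $\rho$ and the same complementarity spectrum $$\Pi(\widehat{\infty}(r,s))=\Pi(\widehat{\infty}(s,r))=\{0,1,\rho\},$$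 where $\rho=\rho(\widehat{\infty}(r,s))=\rho(\widehat{\infty}(s,r))$ is the largest real root of the polynomial $x^n-x^{n-r}-x^{n-s}-1$. -/

import Mathlib

namespace Digraph

/-- The order (number of vertices) of a digraph. -/
noncomputable def order {V : Type*} (_G : Digraph V) : ℕ := Nat.card V

/-- The size (number of arcs) of a digraph. -/
noncomputable def size {V : Type*} (G : Digraph V) : ℕ :=
  Set.ncard {p : V × V | G.Adj p.1 p.2}

/-- Two digraphs are isomorphic if some bijection of the vertices preserves and reflects arcs. -/
def Isomorphic {V W : Type*} (G : Digraph V) (H : Digraph W) : Prop :=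
  Nonempty (G.Adj ≃r H.Adj)

open Classical in
/-- The adjacency matrix: the entry `(i, j)` is `1` if `(i, j)` is an arc, and `0` otherwise. -/
noncomputable def adjMatrix {V : Type*} (G : Digraph V) : Matrix V V ℝ :=
  Matrix.of fun i j => if G.Adj i j then 1 else 0

end Digraph

/-- The complementarity spectrum of a real square matrix `A`: the real numbers `μ` for which there
is a nonzero vector `x ≥ 0` with `A x ≥ μ x` (coordinatewise) and `⟨x, A x - μ x⟩ = 0`. -/
def Matrix.complSpectrum {V : Type*} [Fintype V] (A : Matrix V V ℝ) : Set ℝ :=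
  {μ : ℝ | ∃ x : V → ℝ, x ≠ 0 ∧ 0 ≤ x ∧ μ • x ≤ A.mulVec x ∧
    dotProduct x (A.mulVec x - μ • x) = 0}

namespace Digraph

/-- The complementarity spectrum of a digraph is that of its adjacency matrix. -/
def complSpectrum {V : Type*} [Fintype V] (G : Digraph V) : Set ℝ :=
  G.adjMatrix.complSpectrum

/-- The spectral radius of a digraph: the largest modulus of the (complex) eigenvalues of its
adjacency matrix. -/
noncomputable def spectralRadius {V : Type*} [Fintype V] [DecidableEq V] (G : Digraph V) : ℝ :=
  (_root_.spectralRadius ℂ (G.adjMatrix.map (fun a : ℝ => (a : ℂ)))).toReal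

/-- The directed cycle on `r` vertices. The element `i` of `Fin r` stands for the vertex with
label `i + 1`, so the arcs are `(1, 2), …, (r - 1, r), (r, 1)`. -/
def dirCycle (r : ℕ) : Digraph (Fin r) where
  Adj i j := j.val = (i.val + 1) % r

/-- The map from the vertices of the second digraph to those of the coalescence, in which the vertex
`v` of the second digraph is identified with the vertex `u` of the first one. -/
def coalRight {V W : Type*} [DecidableEq W] (u : V) (v : W) (w : W) : V ⊕ {w : W // w ≠ v} :=
  if h : w = v then Sum.inl u else Sum.inr ⟨w, h⟩

/-- The coalescence of two digraphs: their disjoint union, with the vertex `u` of `G` and the vertex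
`v` of `H` identified. -/
def coalescence {V W : Type*} [DecidableEq W] (G : Digraph V) (u : V) (H : Digraph W) (v : W) :
    Digraph (V ⊕ {w : W // w ≠ v}) where
  Adj a b :=
    (∃ x y, G.Adj x y ∧ a = Sum.inl x ∧ b = Sum.inl y) ∨
    (∃ x y, H.Adj x y ∧ a = coalRight u v x ∧ b = coalRight u v y)

/-- The digraph obtained from `G` by adding the arc `(a, b)`. -/
def addArc {V : Type*} (G : Digraph V) (a b : V) : Digraph V where
  Adj x y := G.Adj x y ∨ (x = a ∧ y = b)

/-- The vertices of the coalescence of two directed cycles at their vertices `1` and `1'`. -/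
abbrev InftyVertex (r s : ℕ) (hs : 2 ≤ s) : Type :=
  Fin r ⊕ {j : Fin s // j ≠ ⟨0, by omega⟩}

/-- The digraph `∞(r, s)`: the coalescence of the directed cycles on `1, …, r` and on
`1', …, s'`, with `1` and `1'` identified. -/
def infty (r s : ℕ) (hr : 2 ≤ r) (hs : 2 ≤ s) : Digraph (InftyVertex r s hs) :=
  coalescence (dirCycle r) ⟨0, by omega⟩ (dirCycle s) ⟨0, by omega⟩

/-- The digraph `∞̂(r, s)`: the digraph `∞(r, s)` with the additional arc `(r, 2')`. -/
def inftyHat (r s : ℕ) (hr : 2 ≤ r) (hs : 2 ≤ s) : Digraph (InftyVertex r s hs) :=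
  (infty r s hr hs).addArc (Sum.inl ⟨r - 1, by omega⟩)
    (coalRight (⟨0, by omega⟩ : Fin r) (⟨0, by omega⟩ : Fin s) ⟨1, by omega⟩)

end Digraph

open Finset

namespace Digraph

/-! Read along its Hamiltonian cycle, `∞̂(r, s)` is `chordedCycle r (s - 1)`, with `n = r + t`
vertices for `t = s - 1`. Solving `A y = c y` round the cycle from `y r = 1` leaves a single closing
condition, `c ^ n - c ^ t - c ^ (r - 1) - 1 = 0`. Interchanging `r` and `s` merely swaps the
exponents `t` and `r - 1`, so both digraphs share this polynomial and its only positive root `ρ`. At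
`ρ` the solution is a positive eigenvector, which forces the spectral radius to be `ρ`.

A complementarity eigenvalue is a `c` for which some nonzero `x ≥ 0` satisfies `A x = c x` on its
support. If `c > 0`, positivity propagates backwards or forwards until it reaches vertex `0`. From
there the mass lies on one of the two branches `0 → 1` and `0 → r`, giving a power of `c` equal to
`1`, or on both, giving the polynomial.

The digraphs themselves differ in the length of the path between their two vertices of out-degree
two. -/

/-- The directed cycle `0 → 1 → ⋯ → r + t - 1 → 0` with the two chords `r - 1 → 0` and `0 → r`. -/
def chordedCycle (r t : ℕ) : Digraph (Fin (r + t)) where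
  Adj i j := j.val = i.val + 1 ∨ (j.val = 0 ∧ (i.val = r - 1 ∨ i.val = r + t - 1)) ∨
    (i.val = 0 ∧ j.val = r)

theorem adjMatrix_mulVec_apply {V : Type*} [Fintype V] [DecidableEq V] (G : Digraph V)
    (x : V → ℝ) (v : V) (S : Finset V) (hS : ∀ w, G.Adj v w ↔ w ∈ S) :
    G.adjMatrix.mulVec x v = ∑ w ∈ S, x w := by
  simp [Matrix.mulVec, dotProduct, adjMatrix, hS]

/-- The successive positions of the right factor along the Hamiltonian cycle of `∞̂(r, s)`. -/
def inftyHatEquiv (r s : ℕ) (hr : 2 ≤ r) (hs : 2 ≤ s) :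
    InftyVertex r s hs ≃ Fin (r + (s - 1)) where
  toFun := Sum.elim (fun i => ⟨i.val, by omega⟩)
    (fun j => ⟨r + j.1.val - 1, by omega⟩)
  invFun k := if h : k.val < r then Sum.inl ⟨k.val, h⟩ else
    Sum.inr ⟨⟨k.val - r + 1, by omega⟩, by simp⟩
  left_inv := by
    rintro (i | ⟨j, hj⟩)
    · simp
    · have : j.val ≠ 0 := fun h => hj (Fin.ext h)
      have h2 : ¬ (r + j.val - 1 < r) := by omega
      refine (dif_neg h2).trans (congrArg Sum.inr (Subtype.ext (Fin.ext ?_)))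
      simp only [Sum.elim_inr]
      omega
  right_inv := by
    intro k
    by_cases h : k.val < r
    · simp [h]
    · ext
      simp [h]
      omega

theorem inftyHatEquiv_coalRight (r s : ℕ) (hr : 2 ≤ r) (hs : 2 ≤ s) (w : Fin s) :
    (inftyHatEquiv r s hr hs (coalRight (⟨0, by omega⟩ : Fin r) (⟨0, by omega⟩ : Fin s) w)).val =
      if w.val = 0 then 0 else r + w.val - 1 := by
  unfold coalRight
  by_cases h : w = ⟨0, by omega⟩
  · subst h
    simp [inftyHatEquiv]
  · have : w.val ≠ 0 := fun h' => h (Fin.ext h')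
    simp [inftyHatEquiv, h, this]

theorem succ_mod_eq_iff {r i : ℕ} (hi : i < r) (j : ℕ) :
    j = (i + 1) % r ↔ (i + 1 < r ∧ j = i + 1) ∨ (i + 1 = r ∧ j = 0) := by
  rcases Nat.lt_or_ge (i + 1) r with h | h
  · rw [Nat.mod_eq_of_lt h]; omega
  · have : i + 1 = r := by omega
    rw [this, Nat.mod_self]; omega

theorem chordedCycle_adj_inftyHatEquiv (r s : ℕ) (hr : 2 ≤ r) (hs : 2 ≤ s)
    (a b : InftyVertex r s hs) :
    (chordedCycle r (s - 1)).Adj (inftyHatEquiv r s hr hs a) (inftyHatEquiv r s hr hs b) ↔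
      (inftyHat r s hr hs).Adj a b := by
  have key (c : InftyVertex r s hs) (w : Fin s) :
      c = coalRight (⟨0, by omega⟩ : Fin r) (⟨0, by omega⟩ : Fin s) w ↔
      (inftyHatEquiv r s hr hs c).val = if w.val = 0 then 0 else r + w.val - 1 := by
    rw [← inftyHatEquiv_coalRight r s hr hs, ← Fin.ext_iff, Equiv.apply_eq_iff_eq]
  have keyl (c : InftyVertex r s hs) (w : Fin r) :
      c = Sum.inl w ↔ (inftyHatEquiv r s hr hs c).val = w.val := by
    have : w.val = (inftyHatEquiv r s hr hs (Sum.inl w)).val := by simp [inftyHatEquiv]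
    rw [this, ← Fin.ext_iff, Equiv.apply_eq_iff_eq]
  simp only [inftyHat, addArc, infty, coalescence, key, keyl, dirCycle, chordedCycle]
  generalize inftyHatEquiv r s hr hs a = a
  generalize inftyHatEquiv r s hr hs b = b
  obtain ⟨a, ha⟩ := a
  obtain ⟨b, hb⟩ := b
  simp only
  constructor
  · intro h
    by_cases h1 : a = r - 1 ∧ b = r
    · right; simp; omega
    left
    by_cases har : a < r ∧ b < r
    · left
      refine ⟨⟨a, har.1⟩, ⟨b, har.2⟩, ?_, rfl, rfl⟩
      rw [succ_mod_eq_iff har.1]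
      simp only
      omega
    · right
      -- Position `r` on the Hamiltonian cycle is the vertex `2'`, of index `1` in the second
      -- factor, hence the shift; position `0` is the glued vertex.
      refine ⟨⟨if a = 0 then 0 else a + 1 - r, by split_ifs <;> omega⟩,
        ⟨if b = 0 then 0 else b + 1 - r, by split_ifs <;> omega⟩, ?_, ?_, ?_⟩
      · rw [succ_mod_eq_iff (by simp only; split_ifs <;> omega)]
        simp only
        split_ifs <;> omega
      · simp only
        split_ifs <;> omega
      · simp only
        split_ifs <;> omega
  · rintro ((⟨x, y, h, rfl, rfl⟩ | ⟨x, y, h, h1, h2⟩) | ⟨h1, h2⟩)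
    · rw [succ_mod_eq_iff x.2] at h
      omega
    · rw [succ_mod_eq_iff x.2] at h
      split_ifs at h1 h2 <;> omega
    · simp at h2
      omega

/-- `∞̂(r, s)` is a directed cycle with two chords. -/
def inftyHatIso (r s : ℕ) (hr : 2 ≤ r) (hs : 2 ≤ s) :
    (inftyHat r s hr hs).Adj ≃r (chordedCycle r (s - 1)).Adj where
  toEquiv := inftyHatEquiv r s hr hs
  map_rel_iff' := chordedCycle_adj_inftyHatEquiv r s hr hs _ _

/-! ### Invariance under isomorphism -/

section Invariance

variable {V W : Type*} {G : Digraph V} {H : Digraph W}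

theorem order_congr (e : G.Adj ≃r H.Adj) : G.order = H.order :=
  Nat.card_congr e.toEquiv

theorem size_congr (e : G.Adj ≃r H.Adj) : G.size = H.size := by
  unfold size
  refine Set.ncard_congr' (Equiv.subtypeEquiv (e.toEquiv.prodCongr e.toEquiv) ?_)
  rintro ⟨a, b⟩
  exact e.map_rel_iff.symm

theorem adjMatrix_congr (e : G.Adj ≃r H.Adj) :
    H.adjMatrix = Matrix.reindex e.toEquiv e.toEquiv G.adjMatrix := by
  ext i j
  have : H.Adj i j ↔ G.Adj (e.symm i) (e.symm j) := e.symm.map_rel_iff.symm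
  classical exact if_congr this rfl rfl

theorem spectralRadius_congr [Fintype V] [DecidableEq V] [Fintype W] [DecidableEq W]
    (e : G.Adj ≃r H.Adj) : G.spectralRadius = H.spectralRadius := by
  have h : H.adjMatrix.map (fun a : ℝ => (a : ℂ)) =
      Matrix.reindexAlgEquiv ℂ ℂ e.toEquiv (G.adjMatrix.map (fun a : ℝ => (a : ℂ))) := by
    rw [adjMatrix_congr e]
    rfl
  unfold spectralRadius _root_.spectralRadius
  rw [h, AlgEquiv.spectrum_eq]

theorem complSpectrum_subset_of_iso [Fintype V] [Fintype W]
    (e : G.Adj ≃r H.Adj) : G.complSpectrum ⊆ H.complSpectrum := by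
  rintro μ ⟨x, hx0, hx, h1, h2⟩
  have hm : H.adjMatrix.mulVec (x ∘ e.toEquiv.symm) = G.adjMatrix.mulVec x ∘ e.toEquiv.symm := by
    have hx : (x ∘ e.toEquiv.symm) ∘ e.toEquiv.symm.symm = x :=
      funext fun i => congrArg x (e.toEquiv.symm_apply_apply i)
    rw [adjMatrix_congr e, Matrix.reindex_apply, Matrix.submatrix_mulVec_equiv, hx]
  refine ⟨x ∘ e.toEquiv.symm, ?_, fun i => hx _, ?_, ?_⟩
  · intro h
    apply hx0
    ext i
    have h3 := congrFun h (e.toEquiv i)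
    rwa [Function.comp_apply, Equiv.symm_apply_apply] at h3
  · rw [hm]
    exact fun i => h1 _
  · rw [hm, ← h2]
    exact e.toEquiv.symm.sum_comp (fun i => x i * (G.adjMatrix.mulVec x - μ • x) i)

theorem complSpectrum_congr [Fintype V] [Fintype W]
    (e : G.Adj ≃r H.Adj) : G.complSpectrum = H.complSpectrum :=
  (complSpectrum_subset_of_iso e).antisymm (complSpectrum_subset_of_iso e.symm)

end Invariance

/-! ### Perron bound from a positive eigenvector -/

/-- A positive eigenvector determines the spectral radius of a nonnegative matrix. -/
theorem spectralRadius_eq_of_pos_eigenvector {V : Type*} [Fintype V] [DecidableEq V] [Nonempty V]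
    (G : Digraph V) (u : V → ℝ) (hu : ∀ v, 0 < u v) (ρ : ℝ) (h : G.adjMatrix.mulVec u = ρ • u) :
    G.spectralRadius = ρ := by
  set B := G.adjMatrix.map (fun a : ℝ => (a : ℂ)) with hB
  have hA (i j : V) : 0 ≤ G.adjMatrix i j := by
    simp only [adjMatrix, Matrix.of_apply]; split_ifs <;> norm_num
  have hmem (μ : ℂ) : μ ∈ spectrum ℂ B ↔ ∃ z : V → ℂ, z ≠ 0 ∧ B.mulVec z = μ • z := by
    rw [← Matrix.spectrum_toLin', ← Module.End.hasEigenvalue_iff_mem_spectrum]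
    constructor
    · intro hμ
      obtain ⟨z, hz⟩ := hμ.exists_hasEigenvector
      exact ⟨z, hz.2, by simpa using hz.apply_eq_smul⟩
    · rintro ⟨z, hz0, hz⟩
      exact Module.End.hasEigenvalue_of_hasEigenvector
        ⟨Module.End.mem_eigenspace_iff.2 (by simpa using hz), hz0⟩
  have hρ : 0 ≤ ρ := by
    obtain ⟨v⟩ := ‹Nonempty V›
    have h1 := congrFun h v
    have h2 : 0 ≤ G.adjMatrix.mulVec u v :=
      Finset.sum_nonneg fun j _ => mul_nonneg (hA v j) (hu j).le
    rw [h1] at h2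
    exact nonneg_of_mul_nonneg_left h2 (hu v)
  have hle (μ : ℂ) (hμ : μ ∈ spectrum ℂ B) : ‖μ‖ ≤ ρ := by
    obtain ⟨z, hz0, hz⟩ := (hmem μ).1 hμ
    -- In the max norm weighted by `u`, the matrix has operator norm at most `ρ`; the bound is read
    -- off where this norm of `z` is attained.
    obtain ⟨v, hv⟩ := Finite.exists_max (fun v => ‖z v‖ / u v)
    have hzv : 0 < ‖z v‖ := by
      obtain ⟨w, hw⟩ := Function.ne_iff.1 hz0
      have h1 : 0 < ‖z w‖ / u w := div_pos (norm_pos_iff.2 hw) (hu w)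
      have h2 := h1.trans_le (hv w)
      exact (div_pos_iff_of_pos_right (hu v)).1 h2
    have hb (w : V) : ‖z w‖ ≤ ‖z v‖ / u v * u w := (div_le_iff₀ (hu w)).1 (hv w)
    have h3 : ‖μ‖ * ‖z v‖ ≤ ρ * ‖z v‖ := by
      calc ‖μ‖ * ‖z v‖ = ‖∑ w, B v w * z w‖ := by
            rw [← norm_mul]; exact congrArg norm (congrFun hz v).symm
        _ ≤ ∑ w, ‖B v w * z w‖ := norm_sum_le _ _
        _ ≤ ∑ w, ‖z v‖ / u v * (G.adjMatrix v w * u w) := by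
            refine Finset.sum_le_sum fun w _ => ?_
            have : ‖B v w‖ = G.adjMatrix v w := by
              simp [hB, abs_of_nonneg (hA v w)]
            rw [norm_mul, this]
            calc _ ≤ G.adjMatrix v w * (‖z v‖ / u v * u w) :=
                  mul_le_mul_of_nonneg_left (hb w) (hA v w)
              _ = _ := by ring
        _ = ‖z v‖ / u v * (ρ * u v) := by
            rw [← Finset.mul_sum]
            exact congrArg _ (congrFun h v)
        _ = ρ * ‖z v‖ := by
            have := (hu v).ne'
            field_simp
    exact le_of_mul_le_mul_right h3 hzv
  have hρmem : (ρ : ℂ) ∈ spectrum ℂ B := by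
    refine (hmem _).2 ⟨fun v => (u v : ℂ), ?_, ?_⟩
    · obtain ⟨v⟩ := ‹Nonempty V›
      exact Function.ne_iff.2 ⟨v, by simpa using (hu v).ne'⟩
    · ext v
      have h1 := congrFun h v
      simp only [Matrix.mulVec, dotProduct, Pi.smul_apply, smul_eq_mul] at h1
      simp only [Matrix.mulVec, dotProduct, Pi.smul_apply, smul_eq_mul, hB, Matrix.map_apply]
      exact_mod_cast h1
  have : _root_.spectralRadius ℂ B = ENNReal.ofReal ρ := by
    unfold _root_.spectralRadius
    apply le_antisymm
    · refine iSup₂_le fun μ hμ => ?_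
      rw [← enorm_eq_nnnorm, ← ofReal_norm]
      exact ENNReal.ofReal_le_ofReal (hle μ hμ)
    · refine le_iSup₂_of_le (ρ : ℂ) hρmem ?_
      rw [← enorm_eq_nnnorm, ← ofReal_norm]
      simp [abs_of_nonneg hρ]
  rw [Digraph.spectralRadius, this, ENNReal.toReal_ofReal hρ]

end Digraph

/-! ### The characteristic polynomial and its positive root -/

theorem exists_unique_pos_root {n a b : ℕ} (ha : a < n) (hb : b < n) :
    ∃ ρ : ℝ, 1 < ρ ∧ ρ ^ n - ρ ^ a - ρ ^ b - 1 = 0 ∧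
      ∀ x : ℝ, 0 < x → x ^ n - x ^ a - x ^ b - 1 = 0 → x = ρ := by
  have huniq (x y : ℝ) (hx : 0 < x) (hxy : x < y) (h1 : x ^ n - x ^ a - x ^ b - 1 = 0)
      (h2 : y ^ n - y ^ a - y ^ b - 1 = 0) : False := by
    -- Scaling by `q > 1` multiplies the leading term by `q ^ n` but each lower term by a smaller
    -- power, strictly so for the constant.
    obtain ⟨q, hq, rfl⟩ : ∃ q : ℝ, 1 < q ∧ y = q * x :=
      ⟨y / x, (one_lt_div hx).2 hxy, (div_mul_cancel₀ y hx.ne').symm⟩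
    simp only [mul_pow] at h2
    have hqa : q ^ a * x ^ a ≤ q ^ n * x ^ a :=
      mul_le_mul_of_nonneg_right (pow_le_pow_right₀ hq.le ha.le) (by positivity)
    have hqb : q ^ b * x ^ b ≤ q ^ n * x ^ b :=
      mul_le_mul_of_nonneg_right (pow_le_pow_right₀ hq.le hb.le) (by positivity)
    have hqn : 1 < q ^ n := one_lt_pow₀ hq (by omega)
    have : q ^ n * x ^ n = q ^ n * x ^ a + q ^ n * x ^ b + q ^ n := by
      linear_combination q ^ n * h1
    linarith
  have hcont : ContinuousOn (fun x : ℝ => x ^ n - x ^ a - x ^ b - 1) (Set.Icc 1 3) := by fun_prop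
  have hmem : (0 : ℝ) ∈ Set.Icc ((1 : ℝ) ^ n - 1 ^ a - 1 ^ b - 1) (3 ^ n - 3 ^ a - 3 ^ b - 1) := by
    refine ⟨by norm_num, ?_⟩
    obtain ⟨m, rfl⟩ : ∃ m, n = m + 1 := ⟨n - 1, by omega⟩
    have h1 : (3 : ℝ) ^ a ≤ 3 ^ m := pow_le_pow_right₀ (by norm_num) (by omega)
    have h2 : (3 : ℝ) ^ b ≤ 3 ^ m := pow_le_pow_right₀ (by norm_num) (by omega)
    have h3 : (1 : ℝ) ≤ 3 ^ m := one_le_pow₀ (by norm_num)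
    rw [pow_succ]
    linarith
  obtain ⟨ρ, hρ, h0⟩ := intermediate_value_Icc (by norm_num) hcont hmem
  have h0 : ρ ^ n - ρ ^ a - ρ ^ b - 1 = 0 := h0
  have h1 : 1 < ρ := by
    refine lt_of_le_of_ne hρ.1 ?_
    rintro rfl
    norm_num at h0
  refine ⟨ρ, h1, h0, fun x hx h => ?_⟩
  rcases lt_trichotomy x ρ with h' | h' | h'
  · exact (huniq x ρ hx h' h h0).elim
  · exact h'
  · exact (huniq ρ x (by linarith) h' h0 h).elim

/-! ### Size, spectral radius and complementarity spectrum of the chorded cycle -/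

namespace Digraph

/-- Each row has its successor on the cycle and at most one chord. Indexing `y` by `ℕ` avoids bound
proofs on shifted indices. -/
theorem chordedCycle_mulVec {r t : ℕ} (hr : 2 ≤ r) (ht : 1 ≤ t) (y : ℕ → ℝ) (i : Fin (r + t)) :
    (chordedCycle r t).adjMatrix.mulVec (fun k => y k.val) i =
      (if i.val = r + t - 1 then y 0 else y (i.val + 1)) +
        (if i.val = 0 then y r else if i.val = r - 1 then y 0 else 0) := by
  obtain ⟨i, hi⟩ := i
  simp only
  by_cases h0 : i = 0
  · subst h0
    rw [adjMatrix_mulVec_apply _ _ _ {⟨1, by omega⟩, ⟨r, by omega⟩}, Finset.sum_pair]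
    · rw [if_neg (by omega), if_pos rfl]
    · simp; omega
    · simp [chordedCycle, Fin.ext_iff]; omega
  by_cases h1 : i = r - 1
  · subst h1
    rw [adjMatrix_mulVec_apply _ _ _ {⟨r - 1 + 1, by omega⟩, ⟨0, by omega⟩}, Finset.sum_pair]
    · rw [if_neg (by omega), if_neg h0, if_pos rfl]
    · simp
    · simp [chordedCycle, Fin.ext_iff]; omega
  by_cases h2 : i = r + t - 1
  · subst h2
    rw [adjMatrix_mulVec_apply _ _ _ {⟨0, by omega⟩}, Finset.sum_singleton]
    · rw [if_pos rfl, if_neg h0, if_neg h1, add_zero]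
    · simp [chordedCycle, Fin.ext_iff]; omega
  · rw [adjMatrix_mulVec_apply _ _ _ {⟨i + 1, by omega⟩}, Finset.sum_singleton]
    · rw [if_neg h2, if_neg h0, if_neg h1, add_zero]
    · simp [chordedCycle, Fin.ext_iff]; omega

theorem size_eq_sum_mulVec {V : Type*} [Fintype V] (G : Digraph V) :
    (G.size : ℝ) = ∑ v, G.adjMatrix.mulVec (fun _ => 1) v := by
  classical
  have h : {p : V × V | G.Adj p.1 p.2} =
      ((Finset.univ.filter fun p : V × V => G.Adj p.1 p.2 : Finset (V × V)) : Set (V × V)) := by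
    ext p; simp
  rw [size, h, Set.ncard_coe_finset, ← Finset.sum_boole, Fintype.sum_prod_type]
  simp only [Matrix.mulVec, dotProduct, adjMatrix, Matrix.of_apply, mul_one]

theorem size_chordedCycle {r t : ℕ} (hr : 2 ≤ r) (ht : 1 ≤ t) :
    (chordedCycle r t).size = r + t + 2 := by
  have h := size_eq_sum_mulVec (chordedCycle r t)
  have h1 (i : Fin (r + t)) := chordedCycle_mulVec hr ht (fun _ => 1) i
  simp only [h1] at h
  have h2 (i : Fin (r + t)) : ((if i.val = r + t - 1 then (1 : ℝ) else 1) +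
        (if i.val = 0 then 1 else if i.val = r - 1 then 1 else 0)) =
      1 + ((if i = ⟨0, by omega⟩ then 1 else 0) + (if i = ⟨r - 1, by omega⟩ then 1 else 0)) := by
    simp only [Fin.ext_iff]
    split_ifs <;> first | omega | norm_num
  simp only [h2, Finset.sum_add_distrib, Finset.sum_ite_eq', Finset.mem_univ, if_true] at h
  simp at h
  have h3 : ((chordedCycle r t).size : ℝ) = ((r + t + 2 : ℕ) : ℝ) := by
    rw [h]; push_cast; ring
  exact_mod_cast h3

theorem exists_pos_eigenvector_chordedCycle {r t : ℕ} (hr : 2 ≤ r) (ht : 1 ≤ t) {ρ : ℝ}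
    (hρ : 1 < ρ) (h : ρ ^ (r + t) - ρ ^ t - ρ ^ (r - 1) - 1 = 0) :
    ∃ u : Fin (r + t) → ℝ, (∀ v, 0 < u v) ∧
      (chordedCycle r t).adjMatrix.mulVec u = ρ • u := by
  -- Normalised by `y r = 1`: following the cycle gives `y 0 = ρ ^ t`, row `0` then gives `y 1 = ρ ^
  -- (t + 1) - 1`, and row `r - 1` is the polynomial equation.
  set y : ℕ → ℝ := fun k => if k = 0 then ρ ^ t else
    if k < r then ρ ^ (k - 1) * (ρ ^ (t + 1) - 1) else ρ ^ (k - r) with hy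
  have h1 : 1 < ρ ^ (t + 1) := one_lt_pow₀ hρ (by omega)
  have hρ0 : 0 < ρ := by linarith
  refine ⟨fun k => y k.val, fun k => ?_, ?_⟩
  · simp only [hy]
    have : 0 < ρ ^ (t + 1) - 1 := by linarith
    split_ifs <;> positivity
  · ext ⟨i, hi⟩
    rw [chordedCycle_mulVec hr ht]
    simp only [Pi.smul_apply, smul_eq_mul]
    have hy0 : y 0 = ρ ^ t := by simp [hy]
    have hy1 (k : ℕ) (hk : 1 ≤ k) (hk' : k < r) : y k = ρ ^ (k - 1) * (ρ ^ (t + 1) - 1) := by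
      simp only [hy]; rw [if_neg (by omega), if_pos hk']
    have hy2 (k : ℕ) (hk' : r ≤ k) : y k = ρ ^ (k - r) := by
      simp only [hy]; rw [if_neg (by omega), if_neg (by omega)]
    by_cases h0 : i = 0
    · subst h0
      rw [if_neg (by omega), if_pos rfl, hy1 _ le_rfl (by omega), hy2 r le_rfl, hy0]
      simp [pow_succ, mul_comm]
    by_cases h1 : i = r - 1
    · subst h1
      rw [if_neg (by omega), if_neg h0, if_pos rfl, hy1 (r - 1) (by omega) (by omega),
        hy2 _ (by omega), hy0]
      obtain ⟨q, rfl⟩ : ∃ q, r = q + 2 := ⟨r - 2, by omega⟩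
      have e1 : q + 2 - 1 + 1 - (q + 2) = 0 := by omega
      have e2 : q + 2 - 1 - 1 = q := by omega
      have e3 : q + 2 - 1 = q + 1 := by omega
      rw [e1, e2]
      rw [e3] at h
      linear_combination -h
    rw [if_neg h0, if_neg h1, add_zero]
    by_cases h2 : i = r + t - 1
    · subst h2
      rw [if_pos rfl, hy2 (r + t - 1) (by omega), hy0, ← pow_succ']
      congr 1
      omega
    rw [if_neg h2]
    by_cases h3 : i < r
    · rw [hy1 i (by omega) h3, hy1 (i + 1) (by omega) (by omega), ← mul_assoc, ← pow_succ']
      congr 2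
      omega
    · rw [hy2 i (by omega), hy2 (i + 1) (by omega), ← pow_succ']
      congr 1
      omega

/-- The recurrence is only known on the support; `c > 0` keeps each successive entry positive, so it
can be iterated. -/
theorem eq_pow_mul_of_step {y : ℕ → ℝ} {c : ℝ} (hc : 0 < c) {a b : ℕ} (hab : a ≤ b)
    (hstep : ∀ k, a ≤ k → k < b → 0 < y k → c * y k = y (k + 1)) (ha : 0 < y a) :
    y b = c ^ (b - a) * y a := by
  obtain ⟨m, rfl⟩ := Nat.exists_eq_add_of_le hab
  induction m with
  | zero => simp
  | succ m ih =>
    have h1 := ih (by omega) fun k h1 h2 => hstep k h1 (by omega)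
    rw [Nat.add_sub_cancel_left] at h1 ⊢
    have h2 := hstep (a + m) (by omega) (by omega) (by rw [h1]; positivity)
    rw [← add_assoc, ← h2, h1, pow_succ']
    ring

/-- A vanishing sum of nonnegative products vanishes termwise, giving equality on the support; off
the support the inequality is automatic since `A ≥ 0`. -/
theorem mem_complSpectrum_iff {V : Type*} [Fintype V] (G : Digraph V) (μ : ℝ) :
    μ ∈ G.complSpectrum ↔ ∃ x : V → ℝ, x ≠ 0 ∧ 0 ≤ x ∧
      ∀ v, 0 < x v → μ * x v = G.adjMatrix.mulVec x v := by
  have hA (i j : V) : 0 ≤ G.adjMatrix i j := by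
    simp only [adjMatrix, Matrix.of_apply]; split_ifs <;> norm_num
  constructor
  · rintro ⟨x, hx0, hx, h1, h2⟩
    refine ⟨x, hx0, hx, fun v hv => ?_⟩
    have h3 := (Finset.sum_eq_zero_iff_of_nonneg
      fun i _ => mul_nonneg (hx i) (sub_nonneg.2 (h1 i))).1 h2 v (Finset.mem_univ v)
    exact (sub_eq_zero.1 ((mul_eq_zero.1 h3).resolve_left hv.ne')).symm
  · rintro ⟨x, hx0, hx, h⟩
    refine ⟨x, hx0, hx, fun v => ?_, Finset.sum_eq_zero fun v _ => ?_⟩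
    · rcases (hx v).eq_or_lt with h0 | h0
      · have h0 : x v = 0 := h0.symm
        simp only [Pi.smul_apply, h0, smul_zero]
        exact Finset.sum_nonneg fun j _ => mul_nonneg (hA v j) (hx j)
      · exact (h v h0).le
    · rcases (hx v).eq_or_lt with h0 | h0
      · have h0 : x v = 0 := h0.symm
        rw [h0, zero_mul]
      · simp [← h v h0]

theorem complSpectrum_chordedCycle {r t : ℕ} (hr : 2 ≤ r) (ht : 1 ≤ t) {ρ : ℝ}
    (hρ : 1 < ρ) (h : ρ ^ (r + t) - ρ ^ t - ρ ^ (r - 1) - 1 = 0)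
    (huniq : ∀ x : ℝ, 0 < x → x ^ (r + t) - x ^ t - x ^ (r - 1) - 1 = 0 → x = ρ) :
    (chordedCycle r t).complSpectrum = {0, 1, ρ} := by
  ext c
  rw [mem_complSpectrum_iff]
  simp only [Set.mem_insert_iff, Set.mem_singleton_iff]
  constructor
  · rintro ⟨x, hx0, hx, hxc⟩
    obtain ⟨y, hy, rfl⟩ : ∃ y : ℕ → ℝ, (∀ k, 0 ≤ y k) ∧ x = fun k => y k.val := by
      refine ⟨fun k => if hk : k < r + t then x ⟨k, hk⟩ else 0, fun k => ?_, ?_⟩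
      · dsimp only
        split_ifs
        exacts [hx _, le_rfl]
      · ext k
        simp
    have hxc (k : ℕ) (hk : k < r + t) (hk0 : 0 < y k) :
        c * y k = (if k = r + t - 1 then y 0 else y (k + 1)) +
          (if k = 0 then y r else if k = r - 1 then y 0 else 0) := by
      rw [← chordedCycle_mulVec hr ht y ⟨k, hk⟩]
      exact hxc ⟨k, hk⟩ hk0
    obtain ⟨⟨k, hk⟩, hk0⟩ := Function.ne_iff.1 hx0
    have hk0 : 0 < y k := (hy k).lt_of_ne' hk0
    have hc0 : 0 ≤ c := by
      have h1 := hxc k hk hk0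
      refine nonneg_of_mul_nonneg_left ?_ hk0
      rw [h1]
      split_ifs <;> first | exact add_nonneg (hy _) (hy _) | exact add_nonneg (hy _) le_rfl
    rcases hc0.eq_or_lt with hc0 | hc0
    · exact Or.inl hc0.symm
    right
    have hlow (k : ℕ) (hk : 1 ≤ k) (hk' : k < r - 1) (hk0 : 0 < y k) : c * y k = y (k + 1) := by
      rw [hxc k (by omega) hk0, if_neg (by omega), if_neg (by omega), if_neg (by omega), add_zero]
    have hhigh (k : ℕ) (hk : r ≤ k) (hk' : k < r + t - 1) (hk0 : 0 < y k) :
        c * y k = y (k + 1) := by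
      rw [hxc k (by omega) hk0, if_neg (by omega), if_neg (by omega), if_neg (by omega), add_zero]
    have hlast (h : 0 < y (r + t - 1)) : c * y (r + t - 1) = y 0 := by
      rw [hxc _ (by omega) h, if_pos rfl, if_neg (by omega), if_neg (by omega), add_zero]
    have hmid (h : 0 < y (r - 1)) : c * y (r - 1) = y r + y 0 := by
      rw [hxc _ (by omega) h, if_neg (by omega), if_neg (by omega), if_pos rfl,
        Nat.sub_add_cancel (by omega)]
    have hright (k : ℕ) (hk : r ≤ k) (hk' : k < r + t) (hk0 : 0 < y k) :
        y 0 = c ^ (r + t - k) * y k := by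
      have h1 := eq_pow_mul_of_step hc0 (b := r + t - 1) (by omega)
        (fun j hj hj' => hhigh j (by omega) hj') hk0
      have h2 := hlast (by rw [h1]; positivity)
      rw [← h2, h1, ← mul_assoc, ← pow_succ']
      congr 2
      omega
    have hleft (k : ℕ) (hk : 1 ≤ k) (hk' : k < r) (hk0 : 0 < y k) :
        y r + y 0 = c ^ (r - k) * y k := by
      have h1 := eq_pow_mul_of_step hc0 (b := r - 1) (by omega)
        (fun j hj hj' => hlow j (by omega) hj') hk0
      have h2 := hmid (by rw [h1]; positivity)
      rw [← h2, h1, ← mul_assoc, ← pow_succ']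
      congr 2
      omega
    have hr0 (h : 0 < y r) : 0 < y 0 := by
      rw [hright r le_rfl (by omega) h]; positivity
    have hy0 : 0 < y 0 := by
      rcases Nat.eq_zero_or_pos k with rfl | hkpos
      · exact hk0
      rcases Nat.lt_or_ge k r with hkr | hkr
      · rcases (hy r).eq_or_lt with h0 | h0
        · have h1 := hleft k hkpos hkr hk0
          rw [← h0, zero_add] at h1
          rw [h1]
          positivity
        · exact hr0 h0
      · rw [hright k hkr hk hk0]
        positivity
    have hzero : c * y 0 = y 1 + y r := by
      rw [hxc 0 (by omega) hy0, if_neg (by omega), if_pos rfl]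
    have hone {m : ℕ} (hm : m ≠ 0) (h : y 0 = c ^ m * y 0) : c = 1 := by
      have h1 : c ^ m = 1 := by
        have : (c ^ m - 1) * y 0 = 0 := by linarith
        linarith [(mul_eq_zero.1 this).resolve_right hy0.ne']
      exact (pow_eq_one_iff_of_nonneg hc0.le hm).1 h1
    -- If `y r = 0`, only the cycle through `0, …, r - 1` matters and `c ^ r = 1`; if `y 1 = 0`, the
    -- cycle through `0, r, …, r + t - 1` gives `c ^ (t + 1) = 1`.
    rcases (hy r).eq_or_lt with hr' | hr'
    · left
      rw [← hr', add_zero] at hzero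
      have h1 := hleft 1 le_rfl (by omega) (by rw [← hzero]; positivity)
      rw [← hr', zero_add, ← hzero, ← mul_assoc, ← pow_succ] at h1
      exact hone (by omega) h1
    have h2 := hright r le_rfl (by omega) hr'
    rw [Nat.add_sub_cancel_left] at h2
    rcases (hy 1).eq_or_lt with h1' | h1'
    · left
      rw [← h1', zero_add] at hzero
      rw [← hzero, ← mul_assoc, ← pow_succ] at h2
      exact hone (by omega) h2
    · right
      have h1 := hleft 1 le_rfl (by omega) h1'
      apply huniq c hc0
      have h3 : (c ^ (r + t) - c ^ t - c ^ (r - 1) - 1) * y r = 0 := by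
        rw [h2] at hzero h1
        obtain ⟨q, rfl⟩ : ∃ q, r = q + 1 := ⟨r - 1, by omega⟩
        rw [Nat.add_sub_cancel] at h1 ⊢
        linear_combination c ^ q * hzero - h1
      exact (mul_eq_zero.1 h3).resolve_right hr'.ne'
  · rintro (rfl | rfl | rfl)
    -- For `0`: a single vertex, which carries no loop.
    · let y : ℕ → ℝ := fun k => if k = 0 then 1 else 0
      refine ⟨fun k => y k.val, Function.ne_iff.2 ⟨⟨0, by omega⟩, by simp [y]⟩, fun k => ?_,
        fun v hv => ?_⟩
      · simp only [y]; split_ifs <;> norm_num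
      · have hv0 : v.val = 0 := by
          by_contra hne
          simp [y, hne] at hv
        rw [chordedCycle_mulVec hr ht, if_neg (by omega), if_pos hv0, hv0]
        simp [y]
        omega
    -- For `1`: the indicator of the first cycle, which is an induced subdigraph.
    · let y : ℕ → ℝ := fun k => if k < r then 1 else 0
      refine ⟨fun k => y k.val, Function.ne_iff.2 ⟨⟨0, by omega⟩, by simp [y]; omega⟩, fun k => ?_,
        fun v hv => ?_⟩
      · simp only [y]; split_ifs <;> norm_num
      · have hvr : v.val < r := by
          by_contra hne
          simp [y, hne] at hv
        rw [chordedCycle_mulVec hr ht]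
        simp only [y]
        split_ifs <;> first | omega | norm_num
    · obtain ⟨u, hu, hAu⟩ := exists_pos_eigenvector_chordedCycle hr ht hρ h
      refine ⟨u, Function.ne_iff.2 ⟨⟨0, by omega⟩, (hu _).ne'⟩, fun v => (hu v).le, fun v _ => ?_⟩
      rw [hAu]
      rfl

theorem spectralRadius_chordedCycle {r t : ℕ} (hr : 2 ≤ r) (ht : 1 ≤ t) {ρ : ℝ}
    (hρ : 1 < ρ) (h : ρ ^ (r + t) - ρ ^ t - ρ ^ (r - 1) - 1 = 0) :
    (chordedCycle r t).spectralRadius = ρ := by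
  obtain ⟨u, hu, hAu⟩ := exists_pos_eigenvector_chordedCycle hr ht hρ h
  have : Nonempty (Fin (r + t)) := ⟨⟨0, by omega⟩⟩
  exact spectralRadius_eq_of_pos_eigenvector _ u hu ρ hAu

/-! ### Non-isomorphism -/

/-- A vertex of out-degree at least two. -/
def IsBranching {V : Type*} (G : Digraph V) (v : V) : Prop :=
  ∃ a b, a ≠ b ∧ G.Adj v a ∧ G.Adj v b

theorem IsBranching.map {V W : Type*} {G : Digraph V} {H : Digraph W} (e : G.Adj ≃r H.Adj) {v : V}
    (h : G.IsBranching v) : H.IsBranching (e v) := by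
  obtain ⟨a, b, hab, ha, hb⟩ := h
  exact ⟨e a, e b, e.injective.ne hab, e.map_rel_iff.2 ha, e.map_rel_iff.2 hb⟩

theorem isBranching_chordedCycle {r t : ℕ} (hr : 2 ≤ r) (ht : 1 ≤ t) (v : Fin (r + t)) :
    (chordedCycle r t).IsBranching v ↔ v.val = 0 ∨ v.val = r - 1 := by
  constructor
  · rintro ⟨a, b, hab, ha, hb⟩
    have : a.val ≠ b.val := fun h => hab (Fin.ext h)
    simp only [chordedCycle] at ha hb
    omega
  · rintro (h | h)
    · refine ⟨⟨1, by omega⟩, ⟨r, by omega⟩, ?_, ?_, ?_⟩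
      · simp; omega
      · simp [chordedCycle, h]
      · simp [chordedCycle, h]
    · refine ⟨⟨0, by omega⟩, ⟨r, by omega⟩, ?_, ?_, ?_⟩
      · simp; omega
      · simp [chordedCycle, h]
      · simp [chordedCycle, h]; omega

theorem not_isomorphic_chordedCycle {r s : ℕ} (hr : 2 ≤ r) (hrs : r < s) :
    ¬ (chordedCycle r (s - 1)).Isomorphic (chordedCycle s (r - 1)) := by
  rintro ⟨e⟩
  have hval (a b) (h : (chordedCycle r (s - 1)).Adj a b) :=
    (show (chordedCycle s (r - 1)).Adj (e a) (e b) from e.map_rel_iff.2 h)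
  have hback (a b) (h : (chordedCycle s (r - 1)).Adj (e a) (e b)) :=
    (show (chordedCycle r (s - 1)).Adj a b from e.map_rel_iff.1 h)
  have hbr (v) (h : v.val = 0 ∨ v.val = r - 1) : (e v).val = 0 ∨ (e v).val = s - 1 :=
    (isBranching_chordedCycle (by omega) (by omega) _).1
      (((isBranching_chordedCycle hr (by omega) v).2 h).map e)
  simp only [chordedCycle] at hval hback
  set a : Fin (r + (s - 1)) := ⟨0, by omega⟩ with ha
  set b : Fin (r + (s - 1)) := ⟨r - 1, by omega⟩ with hb
  have hab : (e a).val ≠ (e b).val := by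
    intro h
    have := congrArg Fin.val (e.injective (Fin.ext h))
    simp only [ha, hb] at this
    omega
  have h0 := hbr a (Or.inl rfl)
  have h1 := hbr b (Or.inr rfl)
  -- This arc orients the branching pair: in the target `s - 1 → 0` is an arc, but `0 → s - 1` is
  -- not, because `s ≥ 3`.
  have h2 := hval b a (Or.inr (Or.inl ⟨rfl, Or.inl rfl⟩))
  have ha0 : (e a).val = 0 := by omega
  have hb0 : (e b).val = s - 1 := by omega
  have hfix (k : ℕ) (hk : k < r) : (e ⟨k, by omega⟩).val = k := by
    induction k with
    | zero => exact ha0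
    | succ k ih =>
      have h3 := ih (by omega)
      have h4 := hval ⟨k, by omega⟩ ⟨k + 1, by omega⟩ (Or.inl rfl)
      -- At `k = 0` this excludes the image `s`: both target branching vertices point to `s`,
      -- whereas `r - 1` does not point to `1`. Later images are forced as `k < s - 1`.
      have h5 := hback b ⟨k + 1, by omega⟩
      simp only at h5
      have h6 : b.val = r - 1 := rfl
      omega
  have h7 : (e b).val = r - 1 := hfix (r - 1) (by omega)
  omega

end Digraph

theorem mainTheorem4 (r s : ℕ) (hr : 2 ≤ r) (hs : 2 ≤ s) (hrs : r < s) :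
    ¬ (Digraph.inftyHat r s hr hs).Isomorphic (Digraph.inftyHat s r hs hr) ∧
    ((Digraph.inftyHat r s hr hs).order = r + s - 1 ∧
      (Digraph.inftyHat s r hs hr).order = r + s - 1) ∧
    ((Digraph.inftyHat r s hr hs).size = r + s + 1 ∧
      (Digraph.inftyHat s r hs hr).size = r + s + 1) ∧
    ∃ ρ : ℝ,
      IsGreatest {x : ℝ | x ^ (r + s - 1) - x ^ (r + s - 1 - r) - x ^ (r + s - 1 - s) - 1 = 0} ρ ∧
      ((Digraph.inftyHat r s hr hs).spectralRadius = ρ ∧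
        (Digraph.inftyHat s r hs hr).spectralRadius = ρ) ∧
      ((Digraph.inftyHat r s hr hs).complSpectrum = {0, 1, ρ} ∧
        (Digraph.inftyHat s r hs hr).complSpectrum = {0, 1, ρ}) := by
  have e₁ := Digraph.inftyHatIso r s hr hs
  have e₂ := Digraph.inftyHatIso s r hs hr
  have n₁ : r + s - 1 = r + (s - 1) := by omega
  have n₂ : s + (r - 1) = r + (s - 1) := by omega
  have n₃ : r + s - 1 - r = s - 1 := by omega
  have n₄ : r + s - 1 - s = r - 1 := by omega
  obtain ⟨ρ, hρ1, hρ, huniq⟩ :=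
    exists_unique_pos_root (n := r + (s - 1)) (a := s - 1) (b := r - 1) (by omega) (by omega)
  have hρ' : ρ ^ (s + (r - 1)) - ρ ^ (r - 1) - ρ ^ (s - 1) - 1 = 0 := by
    rw [n₂]; linarith
  have huniq' (x : ℝ) (hx : 0 < x) (h : x ^ (s + (r - 1)) - x ^ (r - 1) - x ^ (s - 1) - 1 = 0) :
      x = ρ := huniq x hx (by rw [n₂] at h; linarith)
  refine ⟨?_, ⟨?_, ?_⟩, ⟨?_, ?_⟩, ρ, ⟨?_, ?_⟩, ⟨?_, ?_⟩, ?_, ?_⟩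
  · rintro ⟨e⟩
    exact Digraph.not_isomorphic_chordedCycle hr hrs ⟨(e₁.symm.trans e).trans e₂⟩
  · rw [Digraph.order_congr e₁, Digraph.order, Nat.card_fin, n₁]
  · rw [Digraph.order_congr e₂, Digraph.order, Nat.card_fin, n₁, n₂]
  · rw [Digraph.size_congr e₁, Digraph.size_chordedCycle hr (by omega)]
    omega
  · rw [Digraph.size_congr e₂, Digraph.size_chordedCycle hs (by omega)]
    omega
  · rw [Set.mem_ofPred_eq, n₃, n₄, n₁]
    exact hρ
  · intro x hx
    rw [Set.mem_ofPred_eq, n₃, n₄, n₁] at hx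
    rcases le_or_gt x 0 with h | h
    · linarith
    · exact (huniq x h hx).le
  · rw [Digraph.spectralRadius_congr e₁]
    exact Digraph.spectralRadius_chordedCycle hr (by omega) hρ1 hρ
  · rw [Digraph.spectralRadius_congr e₂]
    exact Digraph.spectralRadius_chordedCycle hs (by omega) hρ1 hρ'
  · rw [Digraph.complSpectrum_congr e₁]
    exact Digraph.complSpectrum_chordedCycle hr (by omega) hρ1 hρ huniq
  · rw [Digraph.complSpectrum_congr e₂]
    exact Digraph.complSpectrum_chordedCycle hs (by omega) hρ1 hρ' huniq'
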